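/- Let $P$ be a simple polygon in the plane with edge set $E$, let $\delta\colon E\to\mathbb{R}^+_0$ be an additive-weight function, and let $n_e$ denote the inward facing unit normal and $\overline{e}$ the supporting line of an edge $e$ of $P$. Let $\mathcal{W}_{P,\delta}(t)$, $t\ge 0$, be the additively-weighted wavefront of $(P,\delta)$: $\mathcal{W}_{P,\delta}(0)$ is the boundary of $P$, and at each time $\mathcal{W}_{P,\delta}(t)$ is the union of the boundaries of finitely many (possibly no) simple polygons with pairwise disjoint interiors and non-overlapping edges. Each edge of these polygons emanates from an edge $e$ of $P$, lies on the line $\overline{e}+\max(0,t-\delta(e))\cdot n_e$, and has its polygon on the side to which $n_e$ points. Between consecutive events (at a discrete set of times) incidences are preserved and the vertices move continuously. At an event the polygons are replaced by simple polygons that enclose the same area and whose edges continue old edges: edges that have shrunk to length zero are removed, polygons are split where a vertex has reached another part of the wavefront, the common portion of parallel edges that have moved into each other is removed, and collapsed polygons vanish. When adjacent edges have become collinear, they may be merged into one edge that continues either of them. Then the roof $$R(P,\delta) := \bigcup_{t\ge 0} \bigl(\mathcal{W}_{P,\delta}(t)\times\{t\}\bigr)\subset\mathbb{R}^2\times\mathbb{R}$$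 is weakly $z$-monotone, i.e., every line parallel to the $z$-axis intersects $R(P,\delta)$ in a connected (possibly empty) set. -/

import Mathlib

open Set Filter Topology
open scoped NNReal

noncomputable section

namespace StraightSkeleton

/-- The Euclidean plane. -/
abbrev Plane : Type := EuclideanSpace ℝ (Fin 2)

/-- A closed polygonal chain is simple if it has at least three vertices and its boundary is
traversed injectively: the half-open edges are nondegenerate and pairwise disjoint.
The edge with index `i` joins the vertex `i` to the cyclically next vertex `finRotate n i`. -/
def IsSimple {n : ℕ} (Q : Polygon Plane n) : Prop :=
  3 ≤ n ∧ Function.Injective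
    (fun q : Fin n × Ico (0 : ℝ) 1 => Q.edgePath ℝ q.1 (q.2 : ℝ))

/-- The interior of a polygon: the points off its boundary that lie in a bounded connected
component of the complement of the boundary. -/
def inside {n : ℕ} (Q : Polygon Plane n) : Set Plane :=
  {p | p ∉ Q.boundary ℝ ∧
    Bornology.IsBounded (connectedComponentIn (Q.boundary ℝ)ᶜ p)}

/-- `m` is the inward facing unit normal of the edge `i` of `Q`: it is a unit vector
perpendicular to the edge and, at every point in the relative interior of the edge, it points
into the interior of `Q`, whereas `-m` does not. -/
def IsInwardNormal {n : ℕ} (Q : Polygon Plane n) (i : Fin n) (m : Plane) : Prop :=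
  ‖m‖ = 1 ∧ inner ℝ m (Q (finRotate n i) - Q i) = 0 ∧
    ∀ x ∈ openSegment ℝ (Q i) (Q (finRotate n i)),
      ∀ᶠ s in 𝓝[>] (0 : ℝ), x + s • m ∈ inside Q ∧ x - s • m ∉ inside Q

/-- The inward facing unit normal `n_e` of the edge `e` (for a simple polygon there is exactly
one vector with the defining property). -/
def inwardNormal {N : ℕ} (P : Polygon Plane N) (e : Fin N) : Plane :=
  Classical.epsilon (IsInwardNormal P e)

/-- The line that carries the wavefront fragments of the edge `e` at time `t`: the supporting
line of `e`, translated by `max (0, t - δ e) • n_e`. -/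
def offsetLine {N : ℕ} (P : Polygon Plane N) (δ : Fin N → ℝ≥0) (e : Fin N) (t : ℝ) :
    Set Plane :=
  (fun x => x + max 0 (t - (δ e : ℝ)) • inwardNormal P e) ''
    (line[ℝ, P e, P (finRotate N e)] : Set Plane)

/-- A moving polygon each of whose edges is labelled with the edge of the input polygon (with
`N` edges) from which it emanates. -/
structure MovingPolygon (N : ℕ) where
  size : ℕ
  label : Fin size → Fin N
  position : ℝ → Polygon Plane size

/-- A finite (possibly empty) collection of labelled moving polygons: the wavefront polygons
between two consecutive events. -/
structure Phase (N : ℕ) where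
  count : ℕ
  polygon : Fin count → MovingPolygon N

namespace Phase

variable {N : ℕ}

/-- The point set formed by (the boundaries of) the polygons at time `t`. -/
def curve (F : Phase N) (t : ℝ) : Set Plane :=
  ⋃ j, ((F.polygon j).position t).boundary ℝ

/-- The points enclosed by the polygons at time `t`. -/
def region (F : Phase N) (t : ℝ) : Set Plane :=
  ⋃ j, inside ((F.polygon j).position t)

/-- `s` is, at time `t`, one of the segments emanated from the input edge `e`. -/
def IsFragment (F : Phase N) (t : ℝ) (e : Fin N) (s : Set Plane) : Prop :=
  ∃ j i, (F.polygon j).label i = e ∧ s = ((F.polygon j).position t).edgeSet ℝ i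

/-- The movement of the wavefront of `(P, δ)` during the time interval `[a, b)`, in which its
combinatorial structure does not change. The positions at time `b` are the limits for `t → b`;
there the polygons may be degenerate. -/
structure Propagates (P : Polygon Plane N) (δ : Fin N → ℝ≥0) (F : Phase N) (a b : ℝ) :
    Prop where
  /-- Vertices move continuously. -/
  continuousOn : ∀ j i, ContinuousOn (fun t => (F.polygon j).position t i) (Icc a b)
  /-- The wavefront polygons are simple. -/
  simple : ∀ j, ∀ t ∈ Ico a b, IsSimple ((F.polygon j).position t)
  /-- A fragment of `e` lies on the (stationary or moving) line prescribed for `e`. -/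
  on_line : ∀ j i, ∀ t ∈ Ico a b, ((F.polygon j).position t).edgeSet ℝ i ⊆
    offsetLine P δ ((F.polygon j).label i) t
  /-- A fragment of `e` has the wavefront polygon on the side to which `n_e` points. -/
  inward : ∀ j i, ∀ t ∈ Ico a b, IsInwardNormal ((F.polygon j).position t) i
    (inwardNormal P ((F.polygon j).label i))
  /-- Fragments of the same edge that are adjacent form one fragment. -/
  label_ne : ∀ j i, (F.polygon j).label (finRotate _ i) ≠ (F.polygon j).label i
  /-- A vertex with interior angle 180° moves perpendicularly to its incident edges. -/
  tangential : ∀ j i, inwardNormal P ((F.polygon j).label (finRotate _ i)) =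
      inwardNormal P ((F.polygon j).label i) →
    ∀ t ∈ Icc a b, ∃ c : ℝ, (F.polygon j).position t (finRotate _ i) =
      (F.polygon j).position a (finRotate _ i) + c • inwardNormal P ((F.polygon j).label i)
  /-- Different wavefront polygons have disjoint interiors ... -/
  disjoint : ∀ j k, j ≠ k → ∀ t ∈ Ico a b,
    Disjoint (inside ((F.polygon j).position t)) (inside ((F.polygon k).position t))
  /-- ... and their edges do not overlap. -/
  no_overlap : ∀ j k, j ≠ k → ∀ t ∈ Ico a b, ∀ i l,
    (((F.polygon j).position t).edgeSet ℝ i ∩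
      ((F.polygon k).position t).edgeSet ℝ l).Subsingleton

/-- The update of the wavefront at the event time `b`, from the old polygons (degenerate at
time `b`) to the new ones. The new polygons bound the same area as the old ones: off the limit
position of the old polygons, a point is enclosed by the new ones if and only if it was enclosed
by the old ones immediately before time `b`. Hence edges of length zero disappear, the common
portion of two parallel edges that have moved into each other disappears, a polygon is split
where one of its vertices has reached another part of it, and collapsed polygons are dropped.
Each new edge continues an old edge with the same label (if adjacent edges have become collinear,
a merged edge may continue either of them). -/
structure Event (F G : Phase N) (b : ℝ) : Prop where
  region_iff : ∀ p, p ∉ F.curve b → (p ∈ G.region b ↔ ∀ᶠ t in 𝓝[<] b, p ∈ F.region t)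
  inherits : ∀ e s, G.IsFragment b e s → ∃ s', F.IsFragment b e s' ∧ (s' ∩ s).Nontrivial

end Phase

/-- An additively-weighted wavefront propagation for the polygon `P` with additive weights `δ`:
an unbounded sequence of event times, starting at time zero, and the wavefront polygons between
consecutive events. Several events may take place at the same time. After the collapse of all
wavefront polygons, the phases are empty. -/
structure Wavefront {N : ℕ} (P : Polygon Plane N) (δ : Fin N → ℝ≥0) where
  time : ℕ → ℝ
  phase : ℕ → Phase N
  time_zero : time 0 = 0
  time_strictMono : StrictMono time
  time_tendsto : Tendsto time atTop atTop
  /-- At time zero the wavefront is `P`. -/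
  initial : (phase 0).curve 0 = P.boundary ℝ
  /-- At time zero, each fragment overlaps the edge of `P` from which it emanates. -/
  initial_label : ∀ e s, (phase 0).IsFragment 0 e s → (P.edgeSet ℝ e ∩ s).Nontrivial
  propagates : ∀ k, (phase k).Propagates P δ (time k) (time (k + 1))
  event : ∀ k, (phase k).Event (phase (k + 1)) (time (k + 1))

namespace Wavefront

variable {N : ℕ} {P : Polygon Plane N} {δ : Fin N → ℝ≥0}

/-- The wavefront at time `t`, as a point set. -/
def atTime (W : Wavefront P δ) (t : ℝ) : Set Plane :=
  ⋃ (k : ℕ) (_ : t ∈ Ico (W.time k) (W.time (k + 1))), (W.phase k).curve t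

/-- The roof: the union of the sets `W(t) × {t}` over all times `t ≥ 0`. -/
def roof (W : Wavefront P δ) : Set (Plane × ℝ) :=
  ⋃ t ∈ Ici (0 : ℝ), W.atTime t ×ˢ {t}

end Wavefront

/-- Weak `z`-monotonicity: every line parallel to the `z`-axis meets the set in a connected
(possibly empty) set. -/
def IsWeaklyZMonotone (R : Set (Plane × ℝ)) : Prop :=
  ∀ p : Plane, IsPreconnected (R ∩ {q | q.1 = p})

end StraightSkeleton

end

/-! The wavefront only moves inwards, so the area it encloses shrinks: for `t₁ ≤ t₂` the open region
at `t₂` lies in the closed region at `t₁` (`region_subset_closedRegion`). At any fixed time, the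
curve lies in the closure of the region, as each edge has interior on one side, and misses the
interior of the closed region, as crossing an edge outwards leaves all polygons. Let `p` be on the
curve at `t₁` and `t₂`, and `t₁ ≤ t ≤ t₂`. Then `p` is in the closed region at `t`; it is not in the
open region at `t`, since it would then be interior to the closed region at `t₁`. So `p` is on the
curve at `t`, and the times at which `p` is on the wavefront form an interval.

Within a phase, shrinking is clear for a point that no vertex passes
(`notMem_inside_of_inward_motion`). Vertex traces, and the limit curve at an event, have Hausdorff
dimension at most one. Their complements are dense, which suffices because regions are open and
closed regions are closed. -/

namespace StraightSkeleton

/-! ### Plane geometry -/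

theorem inner_plane (a b : Plane) : inner ℝ a b = a 0 * b 0 + a 1 * b 1 := by
  simp [PiLp.inner_apply, Fin.sum_univ_two, mul_comm]

theorem norm_sq_plane (a : Plane) : ‖a‖ ^ 2 = a 0 * a 0 + a 1 * a 1 := by
  rw [← real_inner_self_eq_norm_sq, inner_plane]

/-- In dimension two the vectors orthogonal to `m` form a line, so the determinant of `a` and `b`
vanishes. -/
theorem eq_smul_of_inner_eq_zero {m a b : Plane} (hm : ‖m‖ = 1) (ha : inner ℝ m a = 0)
    (hb : inner ℝ m b = 0) (hb0 : b ≠ 0) : a = (inner ℝ a b / inner ℝ b b) • b := by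
  have hbb : inner ℝ b b ≠ 0 := inner_self_ne_zero.2 hb0
  have hm2 := norm_sq_plane m
  rw [hm] at hm2
  simp only [inner_plane] at *
  have h : a 0 * b 1 = a 1 * b 0 := by
    linear_combination (b 1 * m 0 - b 0 * m 1) * ha + (a 0 * m 1 - a 1 * m 0) * hb +
      (a 0 * b 1 - a 1 * b 0) * hm2
  ext k
  rw [PiLp.smul_apply, smul_eq_mul, div_mul_eq_mul_div, eq_div_iff hbb]
  fin_cases k
  · simp only [Fin.zero_eta]
    linear_combination b 1 * h
  · simp only [Fin.mk_one]
    linear_combination -b 0 * h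

/-! ### The interior of a polygon -/

section Inside

variable {n : ℕ}

theorem edgeSet_eq_segment (Q : Polygon Plane n) (i : Fin n) :
    Q.edgeSet ℝ i = segment ℝ (Q i) (Q (finRotate n i)) :=
  affineSegment_eq_segment ℝ _ _

theorem isCompact_edgeSet (Q : Polygon Plane n) (i : Fin n) : IsCompact (Q.edgeSet ℝ i) := by
  rw [edgeSet_eq_segment, segment_eq_image_lineMap]
  exact isCompact_Icc.image AffineMap.lineMap_continuous

theorem edgeSet_subset_boundary (Q : Polygon Plane n) (i : Fin n) :
    Q.edgeSet ℝ i ⊆ Q.boundary ℝ := subset_iUnion (fun i => Q.edgeSet ℝ i) i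

theorem mem_boundary_iff (Q : Polygon Plane n) (p : Plane) :
    p ∈ Q.boundary ℝ ↔ ∃ i, p ∈ Q.edgeSet ℝ i := by
  simp [Polygon.boundary]

theorem isCompact_boundary (Q : Polygon Plane n) : IsCompact (Q.boundary ℝ) :=
  isCompact_iUnion fun i => isCompact_edgeSet Q i

theorem mem_inside_of_mem_connectedComponentIn {Q : Polygon Plane n} {p q : Plane}
    (hp : p ∈ inside Q) (hq : q ∈ connectedComponentIn (Q.boundary ℝ)ᶜ p) : q ∈ inside Q :=
  ⟨connectedComponentIn_subset _ _ hq, by rw [← connectedComponentIn_eq hq]; exact hp.2⟩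

theorem mem_inside_of_isPreconnected {Q : Polygon Plane n} {p q : Plane} {s : Set Plane}
    (hs : IsPreconnected s) (hd : Disjoint s (Q.boundary ℝ)) (hps : p ∈ s) (hqs : q ∈ s)
    (hp : p ∈ inside Q) : q ∈ inside Q :=
  mem_inside_of_mem_connectedComponentIn hp
    (hs.subset_connectedComponentIn hps hd.subset_compl_right hqs)

theorem mem_inside_of_segment {Q : Polygon Plane n} {p q : Plane}
    (hd : Disjoint (segment ℝ p q) (Q.boundary ℝ)) (hp : p ∈ inside Q) : q ∈ inside Q :=
  mem_inside_of_isPreconnected (convex_segment p q).isPreconnected hd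
    (left_mem_segment ℝ p q) (right_mem_segment ℝ p q) hp

theorem isOpen_inside (Q : Polygon Plane n) : IsOpen (inside Q) := by
  rw [isOpen_iff_mem_nhds]
  intro p hp
  exact mem_of_superset
    ((isCompact_boundary Q).isClosed.isOpen_compl.connectedComponentIn.mem_nhds
      (mem_connectedComponentIn hp.1))
    fun q hq => mem_inside_of_mem_connectedComponentIn hp hq

/-- The complement is a union of unbounded components of an open set, and these are open. -/
theorem isClosed_inside_union_boundary (Q : Polygon Plane n) :
    IsClosed (inside Q ∪ Q.boundary ℝ) := by
  rw [← isOpen_compl_iff, isOpen_iff_mem_nhds]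
  intro p hp
  have hpb : p ∈ (Q.boundary ℝ)ᶜ := fun h => hp (Or.inr h)
  refine mem_of_superset
    ((isCompact_boundary Q).isClosed.isOpen_compl.connectedComponentIn.mem_nhds
      (mem_connectedComponentIn hpb)) fun q hq => ?_
  rintro (h | h)
  · refine hp (Or.inl (mem_inside_of_mem_connectedComponentIn h ?_))
    rw [← connectedComponentIn_eq hq]
    exact mem_connectedComponentIn hpb
  · exact connectedComponentIn_subset _ _ hq h

theorem IsSimple.edge_ne {Q : Polygon Plane n} (hQ : IsSimple Q) (i : Fin n) :
    Q i ≠ Q (finRotate n i) := by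
  intro h
  have := @hQ.2 (i, ⟨0, by simp⟩) (i, ⟨1 / 2, by norm_num⟩)
    (by simp only [Polygon.edgePath, ← h, AffineMap.lineMap_same, AffineMap.const_apply])
  have h2 := congrArg (fun q => (q.2 : ℝ)) this
  norm_num at h2

theorem IsSimple.notMem_edgeSet {Q : Polygon Plane n} (hQ : IsSimple Q) {i j : Fin n}
    (hij : j ≠ i) {x : Plane} (hx : x ∈ openSegment ℝ (Q i) (Q (finRotate n i))) :
    x ∉ Q.edgeSet ℝ j := by
  rw [openSegment_eq_image_lineMap] at hx
  obtain ⟨s, hs, rfl⟩ := hx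
  rw [Polygon.edgeSet_eq_image_edgePath]
  rintro ⟨r, hr, h⟩
  rcases hr.2.lt_or_eq with hr1 | rfl
  · have := @hQ.2 (j, ⟨r, hr.1, hr1⟩) (i, ⟨s, hs.1.le, hs.2⟩) h
    exact hij (congrArg Prod.fst this)
  -- Parameter `1` is outside the half-open range; it is parameter `0` of the next edge. That edge
  -- may be `i`, so the contradiction comes from the parameters, `0` against `s > 0`.
  · have := @hQ.2 (finRotate n j, ⟨0, by simp⟩) (i, ⟨s, hs.1.le, hs.2⟩)
      (by simpa [Polygon.edgePath] using h)
    have h2 := congrArg (fun q => (q.2 : ℝ)) this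
    exact hs.1.ne h2

/-! ### Stability under small movements -/

variable {ι : Type*} {l : Filter ι} {v : ι → Polygon Plane n} {Q : Polygon Plane n}

/-- A thickening of a segment is convex, so it contains every segment whose endpoints are close to
the original ones. -/
theorem eventually_disjoint_edgeSet (hv : ∀ i, Tendsto (fun t => v t i) l (𝓝 (Q i)))
    {K : Set Plane} (hK : IsCompact K) {i : Fin n} (hd : Disjoint K (Q.edgeSet ℝ i)) :
    ∀ᶠ t in l, Disjoint K ((v t).edgeSet ℝ i) := by
  obtain ⟨ε, hε, h⟩ := hd.exists_thickenings hK (isCompact_edgeSet Q i).isClosed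
  filter_upwards [Metric.tendsto_nhds.1 (hv i) ε hε,
    Metric.tendsto_nhds.1 (hv (finRotate n i)) ε hε] with t h1 h2
  refine (h.mono_left (Metric.self_subset_thickening hε K)).mono_right ?_
  rw [edgeSet_eq_segment, edgeSet_eq_segment]
  refine ((convex_segment _ _).thickening ε).segment_subset ?_ ?_
  · exact Metric.mem_thickening_iff.2 ⟨_, left_mem_segment ℝ _ _, h1⟩
  · exact Metric.mem_thickening_iff.2 ⟨_, right_mem_segment ℝ _ _, h2⟩

theorem eventually_disjoint_boundary (hv : ∀ i, Tendsto (fun t => v t i) l (𝓝 (Q i)))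
    {K : Set Plane} (hK : IsCompact K) (hd : Disjoint K (Q.boundary ℝ)) :
    ∀ᶠ t in l, Disjoint K ((v t).boundary ℝ) := by
  have : ∀ᶠ t in l, ∀ i, Disjoint K ((v t).edgeSet ℝ i) :=
    eventually_all.2 fun i => eventually_disjoint_edgeSet hv hK
      (hd.mono_right (edgeSet_subset_boundary Q i))
  filter_upwards [this] with t ht
  exact disjoint_iUnion_right.2 ht

/-- Near a point in the relative interior of an edge, an inward normal of the edge tells the
interior of the polygon from its exterior, uniformly for all polygons close to `Q`. -/
theorem exists_chord_neighborhood (hv : ∀ i, Tendsto (fun t => v t i) l (𝓝 (Q i)))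
    (hQ : IsSimple Q) {i : Fin n} {m : Plane}
    (hm : ∀ᶠ t in l, IsInwardNormal (v t) i m) (hmQ : IsInwardNormal Q i m)
    (hs : ∀ᶠ t in l, IsSimple (v t))
    {x : Plane} (hx : x ∈ openSegment ℝ (Q i) (Q (finRotate n i))) :
    ∃ r > 0, ∀ᶠ t in l, ∀ y ∈ Metric.closedBall x r,
      (inner ℝ m (v t i) < inner ℝ m y → y ∈ inside (v t)) ∧
      (inner ℝ m y < inner ℝ m (v t i) → y ∉ inside (v t) ∧ y ∉ (v t).boundary ℝ) ∧
      (inner ℝ m y = inner ℝ m (v t i) →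
        y ∈ openSegment ℝ (v t i) (v t (finRotate n i))) := by
  have hm1 : ‖m‖ = 1 := hmQ.1
  have hmm : inner ℝ m m = (1 : ℝ) := by rw [real_inner_self_eq_norm_sq, hm1]; norm_num
  have hedge : ∀ R : Polygon Plane n, IsInwardNormal R i m →
      ∀ z ∈ R.edgeSet ℝ i, inner ℝ m z = (inner ℝ m (R i) : ℝ) := by
    intro R hR z hz
    rw [edgeSet_eq_segment, segment_eq_image'] at hz
    obtain ⟨s, -, rfl⟩ := hz
    rw [inner_add_right, inner_smul_right, hR.2.1]; ring
  -- a ball that misses the other edges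
  have hr0 : ∃ r > 0, ∀ j, j ≠ i → Disjoint (Metric.closedBall x r) (Q.edgeSet ℝ j) := by
    have hc : IsClosed (⋃ j ∈ {j | j ≠ i}, Q.edgeSet ℝ j) :=
      (toFinite _).isClosed_biUnion fun j _ => (isCompact_edgeSet Q j).isClosed
    have hxc : x ∈ (⋃ j ∈ {j | j ≠ i}, Q.edgeSet ℝ j)ᶜ := by
      simp only [mem_compl_iff, mem_iUnion, not_exists]
      exact fun j hj => hQ.notMem_edgeSet hj hx
    obtain ⟨r, hr, h⟩ := Metric.nhds_basis_closedBall.mem_iff.1 (hc.isOpen_compl.mem_nhds hxc)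
    refine ⟨r, hr, fun j hj => ?_⟩
    exact (disjoint_compl_left_iff_subset.2 subset_rfl).mono h
      (subset_biUnion_of_mem (u := fun j => Q.edgeSet ℝ j) hj)
  obtain ⟨r₀, hr₀, hball⟩ := hr0
  have hball' : ∀ᶠ t in l, ∀ j, j ≠ i →
      Disjoint (Metric.closedBall x r₀) ((v t).edgeSet ℝ j) :=
    eventually_all.2 fun j => by
      by_cases hj : j = i
      · simp [hj]
      · simpa [hj] using eventually_disjoint_edgeSet hv (isCompact_closedBall x r₀) (hball j hj)
  -- the foot of the perpendicular to the edge, and its parameter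
  let foot : ι → Plane → Plane := fun t y => y - (inner ℝ m y - inner ℝ m (v t i)) • m
  let par : ι → Plane → ℝ := fun t y =>
    inner ℝ (foot t y - v t i) (v t (finRotate n i) - v t i) /
      inner ℝ (v t (finRotate n i) - v t i) (v t (finRotate n i) - v t i)
  have hxe : x ∈ Q.edgeSet ℝ i := by
    rw [edgeSet_eq_segment]; exact openSegment_subset_segment ℝ _ _ hx
  have hdQ : Q (finRotate n i) - Q i ≠ 0 := sub_ne_zero.2 (hQ.edge_ne i).symm
  have hfst : Tendsto (fun z : Plane × ι => z.1) (𝓝 x ×ˢ l) (𝓝 x) := tendsto_fst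
  have hvp : ∀ j, Tendsto (fun z : Plane × ι => v z.2 j) (𝓝 x ×ˢ l) (𝓝 (Q j)) :=
    fun j => (hv j).comp tendsto_snd
  have hfoot : Tendsto (fun z : Plane × ι => foot z.2 z.1) (𝓝 x ×ˢ l) (𝓝 x) := by
    have := hfst.sub (((tendsto_const_nhds (x := m)).inner (𝕜 := ℝ) hfst).sub
      ((tendsto_const_nhds (x := m)).inner (𝕜 := ℝ) (hvp i)) |>.smul_const m)
    rw [hedge Q hmQ x hxe, sub_self, zero_smul, sub_zero] at this
    exact this
  have hpar : ∀ᶠ z : Plane × ι in 𝓝 x ×ˢ l, par z.2 z.1 ∈ Ioo (0 : ℝ) 1 := by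
    have hd := (hvp (finRotate n i)).sub (hvp i)
    have hlim := ((hfoot.sub (hvp i)).inner (𝕜 := ℝ) hd).div (hd.inner (𝕜 := ℝ) hd)
      (inner_self_ne_zero.2 hdQ)
    refine hlim.eventually_mem (Ioo_mem_nhds ?_ ?_) <;>
    · rw [openSegment_eq_image'] at hx
      obtain ⟨s, hs, rfl⟩ := hx
      rw [add_sub_cancel_left, inner_smul_left, mul_div_assoc,
        div_self (inner_self_ne_zero.2 hdQ)]
      simpa using by first | exact hs.1 | exact hs.2
  have hall := (hpar.and (hfoot.eventually (Metric.closedBall_mem_nhds x hr₀))).and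
    (hfst.eventually (Metric.closedBall_mem_nhds x hr₀))
  -- The product filter separates into a neighbourhood of `x` and a set of `t`, which makes the
  -- radius uniform in `t`.
  obtain ⟨pa, hpa, pb, hpb, hab⟩ := eventually_prod_iff.1 hall
  obtain ⟨r, hr, hrpa⟩ := Metric.nhds_basis_closedBall.mem_iff.1 hpa
  refine ⟨r, hr, ?_⟩
  filter_upwards [hball', hpb, hm, hs] with t hb hpbt hmt hst y hy
  obtain ⟨⟨hp, hf⟩, hyb⟩ := hab (hrpa hy) hpbt
  have hfm : inner ℝ m (foot t y) = inner ℝ m (v t i) := by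
    simp only [foot, inner_sub_right, inner_smul_right, hmm]; ring
  have hfo : foot t y ∈ openSegment ℝ (v t i) (v t (finRotate n i)) := by
    rw [openSegment_eq_image']
    refine ⟨par t y, hp, ?_⟩
    have := eq_smul_of_inner_eq_zero hm1 (a := foot t y - v t i)
      (by rw [inner_sub_right, hfm, sub_self]) hmt.2.1 (sub_ne_zero.2 (hst.edge_ne i).symm)
    change v t i + par t y • _ = _
    rw [← this]; abel
  have hbd : ∀ z ∈ Metric.closedBall x r₀, z ∈ (v t).boundary ℝ →
      inner ℝ m z = inner ℝ m (v t i) := by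
    intro z hz hzb
    obtain ⟨j, hj⟩ := (mem_boundary_iff _ _).1 hzb
    by_cases hji : j = i
    · subst hji; exact hedge _ hmt z hj
    · exact ((hb j hji).notMem_of_mem_left hz hj).elim
  -- The normal only tells the sides apart close to the foot; the perpendicular segment carries this
  -- to `y`.
  have hev := hmt.2.2 _ hfo
  have hyfoot : y = foot t y + (inner ℝ m y - inner ℝ m (v t i)) • m := by simp [foot]
  -- the half-open segment from the point to its foot misses the boundary
  have hseg : ∀ s : ℝ, foot t y + s • m ∈ segment ℝ (foot t y) y → s ≠ 0 →
      ∀ z ∈ segment ℝ (foot t y + s • m) y, inner ℝ m y ≠ inner ℝ m (v t i) →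
      z ∉ (v t).boundary ℝ := by
    intro s hsm hs0 z hz hne hzb
    have hzball : z ∈ Metric.closedBall x r₀ :=
      (convex_closedBall x r₀).segment_subset
        ((convex_closedBall x r₀).segment_subset hf hyb hsm) hyb hz
    have hzm := hbd z hzball hzb
    set h := inner ℝ m y - inner ℝ m (v t i) with hh
    have hh0 : h ≠ 0 := sub_ne_zero.2 hne
    rw [segment_eq_image'] at hsm hz
    obtain ⟨a, ha, hsa⟩ := hsm
    obtain ⟨b, hb', rfl⟩ := hz
    have hsah : s = a * h := by
      have := congrArg (fun w => inner ℝ m w) hsa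
      simp only [inner_add_right, inner_smul_right, inner_sub_right, hmm, hfm] at this
      rw [hh]; linarith
    have hym : inner ℝ m y = inner ℝ m (v t i) + h := by rw [hh]; ring
    simp only [inner_add_right, inner_smul_right, inner_sub_right, hmm, hfm, hym, hsah] at hzm
    have h0 : h * (a * (1 - b) + b) = 0 := by linear_combination hzm
    rcases mul_eq_zero.1 h0 with h0 | h0
    · exact hh0 h0
    have ha0 : 0 < a := lt_of_le_of_ne ha.1 (by rintro rfl; simp [hsah] at hs0)
    nlinarith [hb'.1, hb'.2, mul_nonneg ha.1 (sub_nonneg.2 hb'.2)]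
  refine ⟨fun hlt => ?_, fun hlt => ?_, fun heq => ?_⟩
  · have hpos : 0 < inner ℝ m y - inner ℝ m (v t i) := sub_pos.2 hlt
    obtain ⟨s, ⟨hin, -⟩, hs0, hsle⟩ := (hev.and (Ioo_mem_nhdsGT hpos)).exists
    have hmem : foot t y + s • m ∈ segment ℝ (foot t y) y := by
      rw [segment_eq_image']
      refine ⟨s / (inner ℝ m y - inner ℝ m (v t i)), ⟨by positivity, ?_⟩, ?_⟩
      · exact (div_le_one hpos).2 hsle.le
      · have : y - foot t y = (inner ℝ m y - inner ℝ m (v t i)) • m := by simp [foot]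
        simp only [this, smul_smul, div_mul_cancel₀ _ hpos.ne']
    exact mem_inside_of_segment (disjoint_left.2 fun z hz => hseg s hmem hs0.ne' z hz hlt.ne') hin
  · have hpos : 0 < inner ℝ m (v t i) - inner ℝ m y := sub_pos.2 hlt
    have hyb' : y ∉ (v t).boundary ℝ := fun h => hlt.ne (hbd y hyb h)
    refine ⟨fun hyin => ?_, hyb'⟩
    obtain ⟨s, ⟨-, hin⟩, hs0, hsle⟩ := (hev.and (Ioo_mem_nhdsGT hpos)).exists
    have hmem : foot t y + (-s) • m ∈ segment ℝ (foot t y) y := by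
      rw [segment_eq_image']
      refine ⟨s / (inner ℝ m (v t i) - inner ℝ m y), ⟨by positivity, ?_⟩, ?_⟩
      · exact (div_le_one hpos).2 hsle.le
      · have : y - foot t y = -(inner ℝ m (v t i) - inner ℝ m y) • m := by simp [foot]
        simp only [this, smul_smul, mul_neg, div_mul_cancel₀ _ hpos.ne']
    apply hin
    rw [sub_eq_add_neg, ← neg_smul]
    refine mem_inside_of_segment ?_ hyin
    rw [segment_symm]
    exact disjoint_left.2 fun z hz => hseg (-s) hmem (neg_ne_zero.2 hs0.ne') z hz hlt.ne
  · have : foot t y = y := by simp [foot, heq]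
    rwa [this] at hfo

end Inside

/-! ### Stability of the interior and inward motion. -/

section Motion

variable {n : ℕ}

theorem notMem_inside_of_ray {Q : Polygon Plane n} {p u : Plane} (hu : u ≠ 0)
    (h : ∀ τ : ℝ, 0 ≤ τ → p + τ • u ∉ Q.boundary ℝ) : p ∉ inside Q := by
  intro hp
  have hs : IsPreconnected ((fun τ : ℝ => p + τ • u) '' Ici 0) :=
    isPreconnected_Ici.image _ (by fun_prop)
  have hsub := hs.subset_connectedComponentIn (x := p) (F := (Q.boundary ℝ)ᶜ)
    ⟨0, by simp, by simp⟩ (by rintro _ ⟨τ, hτ, rfl⟩; exact h τ hτ)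
  obtain ⟨C, hC⟩ := (hp.2.subset hsub).exists_norm_le
  have hu' := norm_pos_iff.2 hu
  have hC0 : 0 ≤ C := (norm_nonneg _).trans (hC _ ⟨0, by simp, rfl⟩)
  have h1 := hC _ ⟨(C + ‖p‖ + 1) / ‖u‖, mem_Ici.2 (by positivity), rfl⟩
  have h2 : ‖((C + ‖p‖ + 1) / ‖u‖) • u‖ = C + ‖p‖ + 1 := by
    rw [norm_smul, Real.norm_of_nonneg (by positivity), div_mul_cancel₀ _ hu'.ne']
  have h3 := norm_sub_le (p + ((C + ‖p‖ + 1) / ‖u‖) • u) p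
  rw [add_sub_cancel_left, h2] at h3
  simp only at h1
  linarith

/-- Lines through `p` in the infinitely many directions `(1, k)` meet only in `p`, so each vertex
lies on at most one of them. -/
theorem exists_ray_avoiding_vertices (Q : Polygon Plane n) {p : Plane} (hp : ∀ i, p ≠ Q i) :
    ∃ u : Plane, u ≠ 0 ∧ ∀ i, ∀ τ : ℝ, Q i ≠ p + τ • u := by
  by_contra! hcon
  let u : ℕ → Plane := fun k => !₂[1, (k : ℝ)]
  have hu : ∀ k, u k ≠ 0 := fun k h => by
    have := congrArg (fun w : Plane => w 0) h
    simp [u] at this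
  choose i τ h using fun k => hcon (u k) (hu k)
  obtain ⟨k, k', hne, hk⟩ := Finite.exists_ne_map_eq_of_infinite i
  have e : p + τ k • u k = p + τ k' • u k' := by rw [← h, ← h, hk]
  have e := add_left_cancel e
  have e0 : τ k = τ k' := by simpa [u] using congrArg (fun w : Plane => w 0) e
  have e1 : τ k = 0 ∨ k = k' := by
    have := congrArg (fun w : Plane => w 1) e
    simp only [u, ← e0] at this
    have h2 : τ k * ((k : ℝ) - k') = 0 := by
      simp at this
      rcases this with h | h <;> simp [h]
    rcases mul_eq_zero.1 h2 with h2 | h2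
    · exact Or.inl h2
    · exact Or.inr (by exact_mod_cast sub_eq_zero.1 h2)
  rcases e1 with e1 | e1
  · exact hp (i k) (by simpa [e1] using (h k).symm)
  · exact hne e1

theorem vertex_mem_edgeSet (Q : Polygon Plane n) (i : Fin n) : Q i ∈ Q.edgeSet ℝ i := by
  rw [edgeSet_eq_segment]; exact left_mem_segment ℝ _ _

variable {ι : Type*} {l : Filter ι} {v : ι → Polygon Plane n} {Q : Polygon Plane n}

theorem eventually_boundary_subset_ball (hv : ∀ i, Tendsto (fun t => v t i) l (𝓝 (Q i))) :
    ∃ R : ℝ, ∀ᶠ t in l, (v t).boundary ℝ ⊆ Metric.ball 0 R := by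
  obtain ⟨R, hR⟩ := (finite_range fun i => ‖Q i‖).bddAbove
  refine ⟨R + 1, ?_⟩
  have : ∀ᶠ t in l, ∀ i, ‖v t i‖ < R + 1 := eventually_all.2 fun i =>
    (hv i).norm.eventually (gt_mem_nhds ((hR ⟨i, rfl⟩).trans_lt (lt_add_one R)))
  filter_upwards [this] with t ht
  refine iUnion_subset fun i => ?_
  rw [edgeSet_eq_segment]
  exact (convex_ball _ _).segment_subset (by simpa using ht _) (by simpa using ht _)

/-- Membership in the interior of a polygon is stable under small movements of the polygon. -/
theorem eventually_mem_inside_iff (hv : ∀ i, Tendsto (fun t => v t i) l (𝓝 (Q i)))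
    (hQ : IsSimple Q) {m : Fin n → Plane} (hmQ : ∀ i, IsInwardNormal Q i (m i))
    (hm : ∀ᶠ t in l, ∀ i, IsInwardNormal (v t) i (m i)) (hs : ∀ᶠ t in l, IsSimple (v t))
    {p : Plane} (hp : p ∉ Q.boundary ℝ) :
    ∀ᶠ t in l, (p ∈ inside (v t) ↔ p ∈ inside Q) := by
  obtain ⟨u, hu, hray⟩ := exists_ray_avoiding_vertices Q (p := p) fun i h =>
    hp (edgeSet_subset_boundary Q i (h ▸ vertex_mem_edgeSet Q i))
  have hcont : Continuous fun τ : ℝ => p + τ • u := by fun_prop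
  let S : Set ℝ := {τ | 0 ≤ τ ∧ p + τ • u ∈ Q.boundary ℝ}
  rcases S.eq_empty_or_nonempty with hS | hS
  · have hfree : ∀ τ : ℝ, 0 ≤ τ → p + τ • u ∉ Q.boundary ℝ :=
      fun τ h0 h => (hS ▸ (show τ ∈ S from ⟨h0, h⟩) : τ ∈ (∅ : Set ℝ))
    have hpQ := notMem_inside_of_ray hu hfree
    obtain ⟨R, hR⟩ := eventually_boundary_subset_ball hv
    have hu' := norm_pos_iff.2 hu
    -- From parameter `T` on, the ray is outside the ball containing all nearby polygons; only a
    -- compact piece remains.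
    let T := (R + ‖p‖) / ‖u‖
    have hK : IsCompact ((fun τ : ℝ => p + τ • u) '' Icc 0 T) := isCompact_Icc.image hcont
    have hKd : Disjoint ((fun τ : ℝ => p + τ • u) '' Icc 0 T) (Q.boundary ℝ) := by
      rw [disjoint_left]
      rintro _ ⟨τ, hτ, rfl⟩
      exact hfree τ hτ.1
    filter_upwards [hR, eventually_disjoint_boundary hv hK hKd] with t h1 h2
    refine iff_of_false (notMem_inside_of_ray hu fun τ hτ hb => ?_) hpQ
    rcases le_total τ T with h | h
    · exact h2.notMem_of_mem_left ⟨τ, ⟨hτ, h⟩, rfl⟩ hb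
    · have h3 := h1 hb
      rw [mem_ball_zero_iff] at h3
      have h4 : R + ‖p‖ ≤ τ * ‖u‖ := (div_le_iff₀ hu').1 h
      have h5 := norm_sub_le (p + τ • u) p
      rw [add_sub_cancel_left, norm_smul, Real.norm_of_nonneg hτ] at h5
      linarith
  · have hSc : IsClosed S :=
      isClosed_Ici.inter ((isCompact_boundary Q).isClosed.preimage hcont)
    have hSb : BddBelow S := ⟨0, fun τ h => h.1⟩
    obtain ⟨h0, hx⟩ := hSc.csInf_mem hS hSb
    -- The first hit of the ray lies inside an edge, as vertices are avoided. Just before it, the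
    -- side of that edge decides membership for `Q` and nearby polygons alike, and the segment back
    -- to `p` misses all these boundaries.
    set τ := sInf S with hτ
    have hτ0 : 0 < τ := lt_of_le_of_ne h0 fun h => hp (by simpa [← h] using hx)
    have hbefore : ∀ s, 0 ≤ s → s < τ → p + s • u ∉ Q.boundary ℝ := fun s hs hst hb =>
      (notMem_of_lt_csInf hst hSb) ⟨hs, hb⟩
    obtain ⟨i, hi⟩ := (mem_boundary_iff _ _).1 hx
    rw [edgeSet_eq_segment] at hi
    have hio := mem_openSegment_of_ne_left_right (hray i τ) (hray _ τ) hi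
    obtain ⟨r, hr, hN⟩ := exists_chord_neighborhood hv hQ (hm.mono fun t h => h i) (hmQ i) hs hio
    obtain ⟨r', hr', hN'⟩ := exists_chord_neighborhood (l := pure ()) (v := fun _ => Q)
      (fun i => tendsto_const_nhds) hQ (by simpa using hmQ i) (hmQ i) (by simpa using hQ) hio
    rw [eventually_pure] at hN'
    have hev : ∀ᶠ s in 𝓝[<] τ, p + s • u ∈ Metric.closedBall (p + τ • u) (min r r') :=
      (hcont.tendsto τ).mono_left nhdsWithin_le_nhds
        (Metric.closedBall_mem_nhds _ (lt_min hr hr'))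
    obtain ⟨s, hsb, hs0, hsτ⟩ := (hev.and (Ioo_mem_nhdsLT hτ0)).exists
    have hyr := Metric.closedBall_subset_closedBall (min_le_left r r') hsb
    have hyr' := Metric.closedBall_subset_closedBall (min_le_right r r') hsb
    have hseg : Disjoint (segment ℝ p (p + s • u)) (Q.boundary ℝ) := by
      rw [disjoint_left, segment_eq_image']
      rintro _ ⟨a, ha, rfl⟩
      simp only [add_sub_cancel_left, smul_smul]
      exact hbefore _ (mul_nonneg ha.1 hs0.le)
        ((mul_le_of_le_one_left hs0.le ha.2).trans_lt hsτ)
    have hcomp := segment_eq_image_lineMap ℝ p (p + s • u) ▸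
      isCompact_Icc.image AffineMap.lineMap_continuous
    have hiff : ∀ R : Polygon Plane n, Disjoint (segment ℝ p (p + s • u)) (R.boundary ℝ) →
        (p ∈ inside R ↔ p + s • u ∈ inside R) := fun R hR =>
      ⟨mem_inside_of_segment hR, mem_inside_of_segment (segment_symm ℝ p (p + s • u) ▸ hR)⟩
    obtain ⟨c1, c2, c3⟩ := hN' _ hyr'
    have hlim : Tendsto (fun t => inner ℝ (m i) (v t i)) l (𝓝 (inner ℝ (m i) (Q i))) :=
      tendsto_const_nhds.inner (hv i)
    rcases lt_trichotomy (inner ℝ (m i) (p + s • u)) (inner ℝ (m i) (Q i)) with hlt | heq | hgt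
    · filter_upwards [hN, eventually_disjoint_boundary hv hcomp hseg,
        hlim.eventually (lt_mem_nhds hlt)] with t h1 h2 h3
      rw [hiff _ h2, hiff _ hseg]
      exact iff_of_false ((h1 _ hyr).2.1 h3).1 (c2 hlt).1
    · refine (hbefore s hs0.le hsτ (edgeSet_subset_boundary Q i ?_)).elim
      rw [edgeSet_eq_segment]
      exact openSegment_subset_segment ℝ _ _ (c3 heq)
    · filter_upwards [hN, eventually_disjoint_boundary hv hcomp hseg,
        hlim.eventually (gt_mem_nhds hgt)] with t h1 h2 h3
      rw [hiff _ h2, hiff _ hseg]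
      exact iff_of_true ((h1 _ hyr).1 h3) (c1 hgt)

/-- If the edges of a moving polygon move inwards, then a point that no vertex passes cannot
enter the polygon. -/
theorem notMem_inside_of_inward_motion {v : ℝ → Polygon Plane n} {m : Fin n → Plane} {a b : ℝ}
    (hab : a ≤ b) (hv : ∀ i, ContinuousOn (fun t => v t i) (Icc a b))
    (hs : ∀ t ∈ Icc a b, IsSimple (v t))
    (hm : ∀ t ∈ Icc a b, ∀ i, IsInwardNormal (v t) i (m i))
    (hmono : ∀ i, MonotoneOn (fun t => (inner ℝ (m i) (v t i) : ℝ)) (Icc a b))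
    {p : Plane} (hp : ∀ t ∈ Icc a b, ∀ i, p ≠ v t i) (hpa : p ∉ inside (v a)) :
    p ∉ inside (v b) := by
  have hself : ∀ t, ∀ᶠ t' in 𝓝[Icc a b] t, t' ∈ Icc a b := fun t => self_mem_nhdsWithin
  -- Continuous induction: the set of times at which `p` is not inside is closed and extends to the
  -- right of each of its points.
  have hclosed : IsClosed ({t | p ∉ inside (v t)} ∩ Icc a b) := by
    refine isClosed_of_closure_subset fun t ht => ?_
    have htI : t ∈ Icc a b := closure_minimal inter_subset_right isClosed_Icc ht
    refine ⟨fun hin => ?_, htI⟩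
    have hev := eventually_mem_inside_iff (l := 𝓝[Icc a b] t) (fun i => hv i t htI) (hs t htI)
      (hm t htI) ((hself t).mono hm) ((hself t).mono hs) hin.1
    rw [mem_closure_iff_frequently] at ht
    obtain ⟨t', ⟨h1, h2⟩, h3⟩ := (ht.and_eventually (eventually_nhdsWithin_iff.1 hev)).exists
    exact h1 ((h3 h2).2 hin)
  refine hclosed.Icc_subset_of_forall_mem_nhdsWithin hpa ?_ (right_mem_Icc.2 hab)
  rintro t ⟨htS, htI⟩
  have htI' := Ico_subset_Icc_self htI
  have hle : 𝓝[>] t ≤ 𝓝[Icc a b] t := by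
    rw [← nhdsWithin_Ioc_eq_nhdsGT htI.2]
    exact nhdsWithin_mono _ fun s h => ⟨htI.1.trans h.1.le, h.2⟩
  have hself' := hle (hself t)
  have hvt : ∀ i, Tendsto (fun t => v t i) (𝓝[>] t) (𝓝 (v t i)) :=
    fun i => (hv i t htI').mono_left hle
  -- On the boundary, `p` is in the relative interior of an edge, which then stays or moves inwards
  -- and leaves `p` on the edge or outside. Off the boundary, stability applies.
  by_cases hb : p ∈ (v t).boundary ℝ
  · obtain ⟨i, hi⟩ := (mem_boundary_iff _ _).1 hb
    rw [edgeSet_eq_segment] at hi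
    have hio := mem_openSegment_of_ne_left_right (hp t htI' i).symm (hp t htI' _).symm hi
    obtain ⟨r, hr, hN⟩ := exists_chord_neighborhood hvt (hs t htI')
      (mem_of_superset hself' fun t h => hm t h i) (hm t htI' i)
      (mem_of_superset hself' hs) hio
    have hpm : inner ℝ (m i) p = inner ℝ (m i) (v t i) := by
      rw [segment_eq_image'] at hi
      obtain ⟨s, -, rfl⟩ := hi
      rw [inner_add_right, inner_smul_right, (hm t htI' i).2.1]; ring
    filter_upwards [hN, hself', self_mem_nhdsWithin] with t' h1 h2 h3
    obtain ⟨-, c2, c3⟩ := h1 p (Metric.mem_closedBall_self hr.le)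
    rcases (hpm ▸ hmono i htI' h2 (le_of_lt h3) :
      inner ℝ (m i) p ≤ inner ℝ (m i) (v t' i)).lt_or_eq with h | h
    · exact (c2 h).1
    · refine fun hin => hin.1 (edgeSet_subset_boundary _ i ?_)
      rw [edgeSet_eq_segment]
      exact openSegment_subset_segment ℝ _ _ (c3 h)
  · have hev := eventually_mem_inside_iff hvt (hs t htI')
      (hm t htI') (mem_of_superset hself' hm) (mem_of_superset hself' hs) hb
    filter_upwards [hev] with t' h
    exact fun h' => htS (h.1 h')

end Motion

/-! ### Sets of Hausdorff dimension at most one -/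

theorem dimH_range_smul_add_smul_le {g h : ℝ → ℝ} {K K' : ℝ≥0} (hg : LipschitzWith K g)
    (hh : LipschitzWith K' h) (A B : Plane) :
    dimH (range fun t => g t • A + h t • B) ≤ 1 := by
  have h1 := ((ContinuousLinearMap.toSpanSingleton ℝ A).lipschitz.comp hg).add
    ((ContinuousLinearMap.toSpanSingleton ℝ B).lipschitz.comp hh)
  simpa [Real.dimH_univ] using h1.dimH_range_le

theorem dimH_range_add_smul_le (A B : Plane) : dimH (range fun c : ℝ => A + c • B) ≤ 1 := by
  simpa using dimH_range_smul_add_smul_le (LipschitzWith.const (1 : ℝ)) LipschitzWith.id A B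

theorem dimH_edgeSet_le {n : ℕ} (Q : Polygon Plane n) (i : Fin n) :
    dimH (Q.edgeSet ℝ i) ≤ 1 := by
  refine (dimH_mono ?_).trans (dimH_range_add_smul_le (Q i) (Q (finRotate n i) - Q i))
  rw [edgeSet_eq_segment, segment_eq_image']
  exact image_subset_range _ _

theorem dense_compl_of_dimH_le_one {s : Set Plane} (hs : dimH s ≤ 1) : Dense sᶜ :=
  dense_compl_of_dimH_lt_finrank (hs.trans_lt (by simp))

theorem lipschitzWith_const_add_max (α d : ℝ) : LipschitzWith 1 fun t => α + max 0 (t - d) := by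
  have h1 : LipschitzWith 1 fun t : ℝ => t - d := LipschitzWith.of_dist_le_mul (by simp)
  simpa using (LipschitzWith.const α).add (h1.const_max 0)

/-- Recovers a vertex from its heights along the normals of its two edges. -/
theorem eq_cramer {a b w : Plane} (hd : a 0 * b 1 - a 1 * b 0 ≠ 0) :
    w = (inner ℝ a w : ℝ) • ((a 0 * b 1 - a 1 * b 0)⁻¹ • (!₂[b 1, -b 0] : Plane)) +
      (inner ℝ b w : ℝ) • ((a 0 * b 1 - a 1 * b 0)⁻¹ • (!₂[-a 1, a 0] : Plane)) := by
  ext k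
  rw [inner_plane, inner_plane]
  fin_cases k <;> simp <;> field_simp <;> ring

theorem eq_or_eq_neg_of_det_eq_zero {a b : Plane} (ha : ‖a‖ = 1) (hb : ‖b‖ = 1)
    (hd : a 0 * b 1 - a 1 * b 0 = 0) : b = a ∨ b = -a := by
  have ha2 := norm_sq_plane a
  rw [ha] at ha2
  -- Both vectors are orthogonal to `a` turned by a right angle.
  have h := eq_smul_of_inner_eq_zero (m := !₂[-a 1, a 0]) (a := b) (b := a)
    (by
      rw [← sq_eq_sq₀ (norm_nonneg _) zero_le_one, norm_sq_plane]
      simp only [Matrix.cons_val_zero, Matrix.cons_val_one]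
      linarith)
    (by rw [inner_plane]; simp; linarith) (by rw [inner_plane]; simp; ring)
    (norm_ne_zero_iff.1 (by rw [ha]; exact one_ne_zero))
  set c : ℝ := inner ℝ b a / inner ℝ a a
  have hc : |c| = 1 := by
    have := congrArg norm h
    rwa [norm_smul, ha, hb, mul_one, Real.norm_eq_abs, eq_comm] at this
  rcases (abs_eq zero_le_one).1 hc with hc | hc
  · left; rw [h, hc, one_smul]
  · right; rw [h, hc, neg_one_smul]

/-! ### The lines that carry the wavefront -/

variable {N n : ℕ} {P : Polygon Plane N} {δ : Fin N → ℝ≥0}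

theorem inner_eq_of_edgeSet_subset_offsetLine {Q : Polygon Plane n} (hQ : IsSimple Q)
    {i : Fin n} {e : Fin N} {t : ℝ} (hon : Q.edgeSet ℝ i ⊆ offsetLine P δ e t)
    (hin : IsInwardNormal Q i (inwardNormal P e)) {x : Plane} (hx : x ∈ Q.edgeSet ℝ i) :
    inner ℝ (inwardNormal P e) x =
      (inner ℝ (inwardNormal P e) (P e) : ℝ) + max 0 (t - δ e) := by
  have key : ∀ y ∈ Q.edgeSet ℝ i, ∃ s : ℝ, y = P e + s • (P (finRotate N e) - P e) +
      max 0 (t - (δ e : ℝ)) • inwardNormal P e := by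
    intro y hy
    obtain ⟨z, hz, rfl⟩ := hon hy
    obtain ⟨s, rfl⟩ := mem_affineSpan_pair_iff_exists_lineMap_eq.1 hz
    exact ⟨s, by simp [AffineMap.lineMap_apply, add_comm]⟩
  have hmm : inner ℝ (inwardNormal P e) (inwardNormal P e) = (1 : ℝ) := by
    rw [real_inner_self_eq_norm_sq, hin.1]; norm_num
  -- The chosen vector `inwardNormal P e` is only known to be normal to the fragment; the fragment
  -- is nondegenerate and parallel to `e`, so orthogonality transfers.
  have hperp : inner ℝ (inwardNormal P e) (P (finRotate N e) - P e) = (0 : ℝ) := by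
    obtain ⟨s, hs⟩ := key (Q i) (vertex_mem_edgeSet Q i)
    obtain ⟨s', hs'⟩ := key (Q (finRotate n i))
      (by rw [edgeSet_eq_segment]; exact right_mem_segment ℝ _ _)
    have hd : Q (finRotate n i) - Q i = (s' - s) • (P (finRotate N e) - P e) := by
      rw [hs, hs', sub_smul]; abel
    have h0 := hin.2.1
    rw [hd, inner_smul_right] at h0
    refine (mul_eq_zero.1 h0).resolve_left fun h => hQ.edge_ne i ?_
    rw [h, zero_smul] at hd
    exact (sub_eq_zero.1 hd).symm
  obtain ⟨s, rfl⟩ := key x hx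
  rw [inner_add_right, inner_add_right, inner_smul_right, inner_smul_right, hperp, hmm]
  ring

namespace Phase

variable {F G : Phase N} {a b : ℝ}

theorem Propagates.inner_eq (h : F.Propagates P δ a b) (j i) {t : ℝ} (ht : t ∈ Ico a b)
    {x : Plane} (hx : x ∈ ((F.polygon j).position t).edgeSet ℝ i) :
    inner ℝ (inwardNormal P ((F.polygon j).label i)) x =
      (inner ℝ (inwardNormal P ((F.polygon j).label i)) (P ((F.polygon j).label i)) : ℝ) +
        max 0 (t - δ ((F.polygon j).label i)) :=
  inner_eq_of_edgeSet_subset_offsetLine (h.simple j t ht) (h.on_line j i t ht)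
    (h.inward j i t ht) hx

/-- If the two normals at the vertex are independent, its heights along them are Lipschitz in `t`
and determine it. If they are equal or opposite, it stays on a fixed line: perpendicular to the
edges by `tangential`, or parallel to them. -/
theorem Propagates.dimH_trace_le (h : F.Propagates P δ a b) (j i) :
    dimH ((fun t => (F.polygon j).position t i) '' Ico a b) ≤ 1 := by
  rcases (Ico a b).eq_empty_or_nonempty with hab | ⟨t₀, ht₀⟩
  · simp [hab]
  have haI : a ∈ Ico a b := ⟨le_rfl, ht₀.1.trans_lt ht₀.2⟩
  obtain ⟨i, rfl⟩ := (finRotate _).surjective i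
  set w : ℝ → Plane := fun t => (F.polygon j).position t (finRotate _ i)
  set m := inwardNormal P ((F.polygon j).label i)
  set m' := inwardNormal P ((F.polygon j).label (finRotate _ i))
  obtain ⟨α, d, h1⟩ : ∃ α d : ℝ, ∀ t ∈ Ico a b, inner ℝ m (w t) = α + max 0 (t - d) :=
    ⟨_, _, fun t ht => h.inner_eq j i ht
      (by rw [edgeSet_eq_segment]; exact right_mem_segment ℝ _ _)⟩
  obtain ⟨α', d', h2⟩ : ∃ α d : ℝ, ∀ t ∈ Ico a b, inner ℝ m' (w t) = α + max 0 (t - d) :=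
    ⟨_, _, fun t ht => h.inner_eq j (finRotate _ i) ht (vertex_mem_edgeSet _ _)⟩
  have hm : ‖m‖ = 1 := (h.inward j i a haI).1
  have hm' : ‖m'‖ = 1 := (h.inward j _ a haI).1
  by_cases hd : m 0 * m' 1 - m 1 * m' 0 = 0
  · rcases eq_or_eq_neg_of_det_eq_zero hm hm' hd with heq | hneg
    · refine (dimH_mono ?_).trans (dimH_range_add_smul_le (w a) m)
      rintro _ ⟨t, ht, rfl⟩
      obtain ⟨c, hc⟩ := h.tangential j i heq t (Ico_subset_Icc_self ht)
      exact ⟨c, hc.symm⟩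
    · refine (dimH_mono ?_).trans
        (dimH_range_add_smul_le ((inner ℝ m (w a) : ℝ) • m) (!₂[-m 1, m 0] : Plane))
      rintro _ ⟨t, ht, rfl⟩
      -- The heights along `m` and `-m` are both nondecreasing, hence constant.
      have hconst : inner ℝ m (w t) = (inner ℝ m (w a) : ℝ) := by
        have e1 := h1 t ht
        have e2 := h1 a haI
        have e3 := h2 t ht
        have e4 := h2 a haI
        rw [hneg, inner_neg_left] at e3 e4
        have m1 := max_le_max_left (0 : ℝ) (sub_le_sub_right ht.1 d)
        have m2 := max_le_max_left (0 : ℝ) (sub_le_sub_right ht.1 d')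
        linarith
      refine ⟨inner ℝ (!₂[-m 1, m 0] : Plane) (w t), ?_⟩
      have hm2 := norm_sq_plane m
      rw [hm] at hm2
      change _ = w t
      rw [← hconst]
      ext k
      rw [inner_plane, inner_plane]
      fin_cases k
      · simp
        linear_combination -(w t 0) * hm2
      · simp
        linear_combination -(w t 1) * hm2
  · refine (dimH_mono ?_).trans
      (dimH_range_smul_add_smul_le (lipschitzWith_const_add_max α d)
        (lipschitzWith_const_add_max α' d')
        ((m 0 * m' 1 - m 1 * m' 0)⁻¹ • (!₂[m' 1, -m' 0] : Plane))
        ((m 0 * m' 1 - m 1 * m' 0)⁻¹ • (!₂[-m 1, m 0] : Plane)))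
    rintro _ ⟨t, ht, rfl⟩
    refine ⟨t, ?_⟩
    have := eq_cramer (w := w t) hd
    rw [h1 t ht, h2 t ht] at this
    exact this.symm

/-! ### The closed region covered by the wavefront polygons -/

/-- The points enclosed by the polygons at time `t`, together with the polygons themselves. -/
def closedRegion (F : Phase N) (t : ℝ) : Set Plane := F.region t ∪ F.curve t

theorem closedRegion_eq (F : Phase N) (t : ℝ) : F.closedRegion t =
    ⋃ j, (inside ((F.polygon j).position t) ∪ ((F.polygon j).position t).boundary ℝ) := by
  rw [closedRegion, region, curve, iUnion_union_distrib]

theorem isOpen_region (F : Phase N) (t : ℝ) : IsOpen (F.region t) :=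
  isOpen_iUnion fun _ => isOpen_inside _

theorem isClosed_closedRegion (F : Phase N) (t : ℝ) : IsClosed (F.closedRegion t) := by
  rw [closedRegion_eq]
  exact isClosed_iUnion_of_finite fun j => isClosed_inside_union_boundary _

/-- Off the vertex traces, a point enclosed by a polygon at `t₂` was enclosed by the same polygon at
`t₁`; density and closedness give the rest. -/
theorem Propagates.region_subset (h : F.Propagates P δ a b) {t₁ t₂ : ℝ} (ht₁ : a ≤ t₁)
    (h₁₂ : t₁ ≤ t₂) (ht₂ : t₂ < b) : F.region t₂ ⊆ F.closedRegion t₁ := by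
  have hI : Icc t₁ t₂ ⊆ Ico a b := fun t ht => ⟨ht₁.trans ht.1, ht.2.trans_lt ht₂⟩
  have hD := dense_compl_of_dimH_le_one
    (s := ⋃ j, ⋃ i, (fun t => (F.polygon j).position t i) '' Ico a b) (by
      simp only [dimH_iUnion, iSup_le_iff]
      exact h.dimH_trace_le)
  refine (hD.open_subset_closure_inter (F.isOpen_region t₂)).trans
    (closure_minimal ?_ (F.isClosed_closedRegion t₁))
  rintro p ⟨hp, hpD⟩
  obtain ⟨j, hj⟩ := mem_iUnion.1 hp
  refine Or.inl (mem_iUnion.2 ⟨j, ?_⟩)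
  by_contra hcon
  refine notMem_inside_of_inward_motion (v := (F.polygon j).position)
    (m := fun i => inwardNormal P ((F.polygon j).label i)) h₁₂
    (fun i => (h.continuousOn j i).mono (hI.trans Ico_subset_Icc_self))
    (fun t ht => h.simple j t (hI ht)) (fun t ht i => h.inward j i t (hI ht)) ?_ ?_ hcon hj
  · intro i s hs t ht hst
    simp only
    rw [h.inner_eq j i (hI hs) (vertex_mem_edgeSet _ _),
      h.inner_eq j i (hI ht) (vertex_mem_edgeSet _ _)]
    gcongr
  · intro t ht i heq
    exact hpD (mem_iUnion.2 ⟨j, mem_iUnion.2 ⟨i, t, hI ht, heq.symm⟩⟩)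

theorem _root_.StraightSkeleton.IsInwardNormal.mem_closure_inside {Q : Polygon Plane n}
    {i : Fin n} {m : Plane} (h : IsInwardNormal Q i m) {p : Plane} (hp : p ∈ Q.edgeSet ℝ i) :
    p ∈ closure (inside Q) := by
  rw [edgeSet_eq_segment, ← closure_openSegment] at hp
  refine closure_minimal (fun x hx => ?_) isClosed_closure hp
  have hlim : Tendsto (fun s : ℝ => x + s • m) (𝓝[>] 0) (𝓝 x) := by
    have : Continuous fun s : ℝ => x + s • m := by fun_prop
    simpa using (this.tendsto 0).mono_left nhdsWithin_le_nhds
  exact mem_closure_of_tendsto hlim ((h.2.2 x hx).mono fun s hs => hs.1)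

theorem Propagates.closedRegion_subset_closure (h : F.Propagates P δ a b) {t : ℝ}
    (ht : t ∈ Ico a b) : F.closedRegion t ⊆ closure (F.region t) := by
  refine union_subset subset_closure (iUnion_subset fun j => iUnion_subset fun i p hp => ?_)
  exact closure_mono (subset_iUnion (fun j => inside ((F.polygon j).position t)) j)
    ((h.inward j i t ht).mem_closure_inside hp)

/-- As `p` may be a vertex or touch another polygon, it is replaced by a nearby point `x` inside its
edge and on no other polygon; only finitely many points of the edge are excluded. Other interiors
also miss `x`, a limit of points of its own polygon's interior. Hence points just outwards of `x`
lie in no polygon. -/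
theorem Propagates.disjoint_interior_closedRegion_curve (h : F.Propagates P δ a b) {t : ℝ}
    (ht : t ∈ Ico a b) : Disjoint (interior (F.closedRegion t)) (F.curve t) := by
  rw [disjoint_left]
  intro p hpi hpc
  obtain ⟨j, hpj⟩ := mem_iUnion.1 hpc
  obtain ⟨i, hi⟩ := (mem_boundary_iff _ _).1 hpj
  set Q := (F.polygon j).position t with hQdef
  have hQ : IsSimple Q := h.simple j t ht
  -- a point of the edge that lies on no other polygon
  have hfin : (⋃ k ∈ {k | j ≠ k}, ⋃ l,
      (Q.edgeSet ℝ i ∩ ((F.polygon k).position t).edgeSet ℝ l)).Finite :=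
    (toFinite _).biUnion fun k hk => finite_iUnion fun l => (h.no_overlap j k hk t ht i l).finite
  obtain ⟨x, hxi, hxo, hxn⟩ : ∃ x ∈ interior (F.closedRegion t),
      x ∈ openSegment ℝ (Q i) (Q (finRotate _ i)) ∧
      x ∉ ⋃ k ∈ {k | j ≠ k}, ⋃ l,
        (Q.edgeSet ℝ i ∩ ((F.polygon k).position t).edgeSet ℝ l) := by
    rw [edgeSet_eq_segment, segment_eq_image_lineMap, ← closure_Ioo zero_ne_one] at hi
    obtain ⟨s, hs, rfl⟩ := hi
    have hcont : Continuous (AffineMap.lineMap (k := ℝ) (Q i) (Q (finRotate _ i))) :=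
      AffineMap.lineMap_continuous
    have hinj : Function.Injective (AffineMap.lineMap (k := ℝ) (Q i) (Q (finRotate _ i))) :=
      AffineMap.lineMap_injective ℝ (hQ.edge_ne i)
    obtain ⟨s', h1, h2⟩ := mem_closure_iff.1 hs _ (isOpen_interior.preimage hcont) hpi
    have hopen : IsOpen (AffineMap.lineMap (k := ℝ) (Q i) (Q (finRotate _ i)) ⁻¹'
        interior (F.closedRegion t) ∩ Ioo 0 1) :=
      (isOpen_interior.preimage hcont).inter isOpen_Ioo
    have hinf := infinite_of_mem_nhds s' (hopen.mem_nhds ⟨h1, h2⟩)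
    obtain ⟨y, hy, hyn⟩ := (hinf.image hinj.injOn).exists_notMem_finite hfin
    obtain ⟨r, hr, rfl⟩ := hy
    refine ⟨_, hr.1, ?_, hyn⟩
    rw [openSegment_eq_image_lineMap]
    exact ⟨r, hr.2, rfl⟩
  have hxe : x ∈ Q.edgeSet ℝ i := by
    rw [edgeSet_eq_segment]; exact openSegment_subset_segment ℝ _ _ hxo
  set m := inwardNormal P ((F.polygon j).label i) with hmdef
  have hm : IsInwardNormal Q i m := h.inward j i t ht
  have hother : ∀ k, j ≠ k → x ∉ inside ((F.polygon k).position t) ∪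
      ((F.polygon k).position t).boundary ℝ := by
    rintro k hk (hin | hb)
    · obtain ⟨y, h1, h2⟩ := mem_closure_iff.1 (hm.mem_closure_inside hxe) _ (isOpen_inside _) hin
      exact disjoint_left.1 (h.disjoint j k hk t ht) h2 h1
    · obtain ⟨l, hl⟩ := (mem_boundary_iff _ _).1 hb
      exact hxn (mem_biUnion (show k ∈ {k | j ≠ k} from hk) (mem_iUnion.2 ⟨l, hxe, hl⟩))
  obtain ⟨r, hr, hN⟩ := exists_chord_neighborhood (l := pure ()) (v := fun _ => Q)
    (fun i => tendsto_const_nhds) hQ (by simpa using hm) hm (by simpa using hQ) hxo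
  rw [eventually_pure] at hN
  have hlim : Tendsto (fun s : ℝ => x - s • m) (𝓝[>] 0) (𝓝 x) := by
    have : Continuous fun s : ℝ => x - s • m := by fun_prop
    simpa using (this.tendsto 0).mono_left nhdsWithin_le_nhds
  have hev : ∀ᶠ y in 𝓝 x, ∀ k, j ≠ k → y ∉ inside ((F.polygon k).position t) ∪
      ((F.polygon k).position t).boundary ℝ := by
    refine eventually_all.2 fun k => ?_
    by_cases hk : j = k
    · simp [hk]
    · exact mem_of_superset
        ((isClosed_inside_union_boundary _).isOpen_compl.mem_nhds (hother k hk)) fun y hy _ => hy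
  obtain ⟨s, ⟨⟨h1, h2⟩, h3⟩, hs0⟩ := (((hlim.eventually hev).and
    (hlim.eventually (Metric.closedBall_mem_nhds x hr))).and
    (hlim.eventually (mem_interior_iff_mem_nhds.1 hxi))).and self_mem_nhdsWithin |>.exists
  have hs0 : 0 < s := hs0
  have hxm : inner ℝ m x = (inner ℝ m (Q i) : ℝ) := by
    rw [edgeSet_eq_segment, segment_eq_image'] at hxe
    obtain ⟨r, -, rfl⟩ := hxe
    rw [inner_add_right, inner_smul_right, hm.2.1]; ring
  have hlt : inner ℝ m (x - s • m) < (inner ℝ m (Q i) : ℝ) := by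
    rw [inner_sub_right, inner_smul_right, real_inner_self_eq_norm_sq, hm.1, hxm]
    linarith
  have hout := (hN _ h2).2.1 hlt
  replace h3 : x - s • m ∈ F.closedRegion t := h3
  rw [closedRegion_eq] at h3
  obtain ⟨k, hk⟩ := mem_iUnion.1 h3
  by_cases hjk : j = k
  · subst hjk
    exact hk.elim hout.1 hout.2
  · exact h1 k hjk hk

/-- At an event, the new region is covered by the old closed regions. -/
theorem Event.region_subset (hE : F.Event G b) (h : F.Propagates P δ a b) {t : ℝ}
    (ht : t ∈ Ico a b) : G.region b ⊆ F.closedRegion t := by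
  -- `region_iff` says nothing on the limit curve, but its complement is dense.
  have hD := dense_compl_of_dimH_le_one (s := F.curve b) (by
    simp only [curve, Polygon.boundary, dimH_iUnion, iSup_le_iff]
    exact fun j i => dimH_edgeSet_le _ i)
  refine (hD.open_subset_closure_inter (G.isOpen_region b)).trans
    (closure_minimal ?_ (F.isClosed_closedRegion t))
  rintro p ⟨hp, hpc⟩
  obtain ⟨s, hs, hst, hsb⟩ :=
    (((hE.region_iff p hpc).1 hp).and (Ioo_mem_nhdsLT ht.2)).exists
  exact h.region_subset ht.1 hst.le hsb hs

end Phase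

/-! ### Shrinking across events, and the times at which a point is on the wavefront. -/

namespace Wavefront

variable (W : Wavefront P δ)

theorem exists_mem_Ico {t : ℝ} (ht : 0 ≤ t) : ∃ k, t ∈ Ico (W.time k) (W.time (k + 1)) := by
  classical
  have hex : ∃ k, t < W.time k := (W.time_tendsto.eventually_gt_atTop t).exists
  obtain ⟨k, hk⟩ : ∃ k, Nat.find hex = k + 1 := Nat.exists_eq_succ_of_ne_zero fun h0 => by
    have := Nat.find_spec hex
    rw [h0, W.time_zero] at this
    exact this.not_ge ht
  exact ⟨k, not_lt.1 (Nat.find_min hex (by omega)), hk ▸ Nat.find_spec hex⟩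

/-- Induction on the number of events in between. Inclusions of open in closed regions do not
compose directly; they are joined by taking closures, each closed region lying in the closure of its
open region. -/
theorem region_subset_closedRegion {k₁ k₂ : ℕ} {t₁ t₂ : ℝ} (h₁₂ : t₁ ≤ t₂)
    (ht₁ : t₁ ∈ Ico (W.time k₁) (W.time (k₁ + 1)))
    (ht₂ : t₂ ∈ Ico (W.time k₂) (W.time (k₂ + 1))) :
    (W.phase k₂).region t₂ ⊆ (W.phase k₁).closedRegion t₁ := by
  have hk : k₁ ≤ k₂ := by
    by_contra! hlt
    exact ((W.time_strictMono.monotone hlt).trans ht₁.1).not_gt (h₁₂.trans_lt ht₂.2)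
  obtain ⟨d, rfl⟩ := Nat.exists_eq_add_of_le hk
  clear hk
  induction d generalizing t₂ with
  | zero => exact (W.propagates k₁).region_subset ht₁.1 h₁₂ ht₂.2
  | succ d ih =>
    -- go back to the event, and then to a late time of the preceding phase
    have hlt : W.time (k₁ + d) < W.time (k₁ + (d + 1)) := W.time_strictMono (by omega)
    have hlt₁ : t₁ < W.time (k₁ + (d + 1)) :=
      ht₁.2.trans_le (W.time_strictMono.monotone (by omega))
    -- This is `t₁` for `d = 0` and the start of the preceding phase otherwise.
    let s := max t₁ (W.time (k₁ + d))
    have hs : s ∈ Ico (W.time (k₁ + d)) (W.time (k₁ + (d + 1))) :=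
      ⟨le_max_right _ _, max_lt hlt₁ hlt⟩
    have e1 := (W.propagates (k₁ + (d + 1))).region_subset le_rfl ht₂.1 ht₂.2
    have e2 := (W.propagates (k₁ + (d + 1))).closedRegion_subset_closure
      ⟨le_rfl, ht₂.1.trans_lt ht₂.2⟩
    have e3 := (W.event (k₁ + d)).region_subset (W.propagates (k₁ + d)) hs
    have e4 := (W.propagates (k₁ + d)).closedRegion_subset_closure hs
    have e5 := ih (le_max_left _ _) hs
    have hc := (W.phase k₁).isClosed_closedRegion t₁
    exact e1.trans (e2.trans (closure_minimal
      (e3.trans (e4.trans (closure_minimal e5 hc))) hc))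

theorem mem_atTime_iff {k : ℕ} {t : ℝ} (ht : t ∈ Ico (W.time k) (W.time (k + 1)))
    (p : Plane) : p ∈ W.atTime t ↔ p ∈ (W.phase k).curve t := by
  simp only [atTime, mem_iUnion]
  refine ⟨?_, fun h => ⟨k, ht, h⟩⟩
  rintro ⟨k', ht', h⟩
  have hk : k' = k := by
    refine le_antisymm ?_ ?_ <;> by_contra! hlt
    · exact ((W.time_strictMono.monotone hlt).trans ht'.1).not_gt ht.2
    · exact ((W.time_strictMono.monotone hlt).trans ht.1).not_gt ht'.2
  exact hk ▸ h

theorem ordConnected_setOf_mem_atTime (p : Plane) :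
    OrdConnected {t : ℝ | 0 ≤ t ∧ p ∈ W.atTime t} := by
  refine ⟨?_⟩
  rintro t₁ ⟨h₁, hp₁⟩ t₂ ⟨h₂, hp₂⟩ t ⟨hl, hr⟩
  have h0 := h₁.trans hl
  refine ⟨h0, ?_⟩
  obtain ⟨k₁, hk₁⟩ := W.exists_mem_Ico h₁
  obtain ⟨k₂, hk₂⟩ := W.exists_mem_Ico h₂
  obtain ⟨k, hk⟩ := W.exists_mem_Ico h0
  rw [W.mem_atTime_iff hk₁] at hp₁
  rw [W.mem_atTime_iff hk₂] at hp₂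
  rw [W.mem_atTime_iff hk]
  have hin : p ∈ (W.phase k).closedRegion t :=
    closure_minimal (W.region_subset_closedRegion hr hk hk₂)
      ((W.phase k).isClosed_closedRegion t)
      ((W.propagates k₂).closedRegion_subset_closure hk₂ (Or.inr hp₂))
  -- Strict enclosure at `t` would make `p` interior to the closed region at `t₁`, where it lies on
  -- the curve.
  refine hin.resolve_left fun hreg => ?_
  have hint : p ∈ interior ((W.phase k₁).closedRegion t₁) :=
    interior_maximal (W.region_subset_closedRegion hl hk₁ hk) ((W.phase k).isOpen_region t) hreg
  exact disjoint_left.1 ((W.propagates k₁).disjoint_interior_closedRegion_curve hk₁) hint hp₁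

end Wavefront

end StraightSkeleton

theorem mainTheorem5 {N : ℕ} (P : Polygon StraightSkeleton.Plane N)
    (hP : StraightSkeleton.IsSimple P) (δ : Fin N → ℝ≥0)
    (W : StraightSkeleton.Wavefront P δ) :
    StraightSkeleton.IsWeaklyZMonotone W.roof := by
  intro p
  have h : W.roof ∩ {q | q.1 = p} =
      (fun t : ℝ => (p, t)) '' {t | 0 ≤ t ∧ p ∈ W.atTime t} := by
    ext ⟨q, t⟩
    simp only [StraightSkeleton.Wavefront.roof, mem_inter_iff, mem_iUnion, mem_prod,
      mem_singleton_iff, mem_ofPred_eq, mem_image, Prod.mk.injEq, mem_Ici]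
    constructor
    · rintro ⟨⟨s, hs, hq, rfl⟩, rfl⟩
      exact ⟨t, ⟨hs, hq⟩, rfl, rfl⟩
    · rintro ⟨s, ⟨hs, hq⟩, rfl, rfl⟩
      exact ⟨⟨s, hs, hq, rfl⟩, rfl⟩
  rw [h]
  exact (W.ordConnected_setOf_mem_atTime p).isPreconnected.image _ (by fun_prop)
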